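/- Let $m,n,d,T$ be non-negative integers, let $\beta,\tau\in\mathbb{R}^d$ be entrywise non-negative with $\|\beta\|_1=\sum_k\beta(k)\ge 1$, and let $G\ge 0$. For $A\in\mathbb{R}^{m\times n\times d}$ and $k\in[d]$ let $\widehat A^{(k)}\in\mathbb{C}^{m\times n}$ be the $k$-th frontal slice of the unitary discrete Fourier transform of $A$ along the third dimension, $$\widehat A^{(k)}(i,j)=\frac1{\sqrt d}\sum_{l=1}^{d}A(i,j,l)\,e^{-2\pi\mathrm{i}(k-1)(l-1)/d}.$$ For $M\in\mathbb{C}^{m\times n}$ put $\mathrm{sym}(M)=\begin{pmatrix}0&M\\M^{\dagger}&0\end{pmatrix}$, a Hermitian matrix of dimension $p=m+n$. For real $b,s$, the matrix $M$ is $(b,s)$-decomposable if there are Hermitian positive semidefinite matrices $P,N\in\mathbb{C}^{p\times p}$ with $\mathrm{sym}(M)=P-N$, with $P(i,i)\le b$ and $N(i,i)\le b$ for all $i$, and with $\mathrm{Tr}(P)+\mathrm{Tr}(N)\le s$. A tensor $A$ is $(\beta,\tau)$-decomposable if $\widehat A^{(k)}$ is $(\beta(k),\tau(k))$-decomposable for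 every $k\in[d]$, and a set of tensors is $(\beta,\tau)$-decomposable if each of its elements is. Let $S\subseteq[-1,1]^{m\times n\times d}$ be a non-empty $(\beta,\tau)$-decomposable set. Online Tensor Prediction over $S$ with $T$ rounds runs as follows. In round $t=1,\dots,T$ the learner maintains a tensor $A_t$ in the closed convex hull of $S$ (which is $S$ itself if $S$ is closed and convex), determined by the rounds before $t$ only; the adversary supplies indices $(i_t,j_t,k_t)\in[m]\times[n]\times[d]$; the learner predicts $p_t=A_t(i_t,j_t,k_t)$; the adversary supplies a convex $G$-Lipschitz function $l_t:[-1,1]\to\mathbb{R}$; and the learner suffers the loss $l_t(p_t)$. The regret is $$\mathrm{Regret}=\sum_{t=1}^{T}l_t(p_t)-\inf_{U\in S}\sum_{t=1}^{T}l_t\bigl(U(i_t,j_t,k_t)\bigr).$$ Then there is an algorithm for the learner (which may depend on $m,n,d,\beta,\tau,G,S$ and $T$) such that, for all choices of the adversary, $$\mathrm{Regret}\le 2G\sqrt{\log(2p)\,T\,\Bigl(\sum_{k=1}^{d}\tau(k)\Bigr)\Bigl(\sum_{k=1}^{d}\beta(k)\Bigr)}.$$ -/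

import Mathlib

open scoped NNReal ComplexOrder

noncomputable section

namespace OnlineTensor

/-- Real tensors of size `m × n × d`. -/
abbrev Tensor (m n d : ℕ) : Type := Fin m → Fin n → Fin d → ℝ

/-- The `k`-th frontal slice of the discrete Fourier transform of `A` along the third dimension.
The transform is unitary: its matrix has the entries `exp (-2πi k l / d) / √d` (indices from
zero), and its inverse is its conjugate transpose. -/
def fourierSlice {m n d : ℕ} (A : Tensor m n d) (k : Fin d) : Matrix (Fin m) (Fin n) ℂ :=
  Matrix.of fun i j =>
    ((1 / Real.sqrt (d : ℝ) : ℝ) : ℂ) *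
      ∑ l : Fin d, (A i j l : ℂ) *
        Complex.exp (-(2 * (Real.pi : ℂ) * Complex.I * ((k : ℕ) : ℂ) * ((l : ℕ) : ℂ) / (d : ℂ)))

/-- The symmetrization of an `m × n` matrix, of dimension `m + n`. The matrices are complex, so
the lower left block is the conjugate transpose (the transpose if the matrix is real). -/
def symmetrization {m n : ℕ} (A : Matrix (Fin m) (Fin n) ℂ) :
    Matrix (Fin m ⊕ Fin n) (Fin m ⊕ Fin n) ℂ :=
  Matrix.fromBlocks 0 A A.conjTranspose 0

/-- `(β, τ)`-decomposability of a matrix. Diagonal entries and traces of positive semidefinite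
matrices are real, so taking real parts loses nothing. -/
def MatrixDecomposable {m n : ℕ} (b t : ℝ) (A : Matrix (Fin m) (Fin n) ℂ) : Prop :=
  ∃ P N : Matrix (Fin m ⊕ Fin n) (Fin m ⊕ Fin n) ℂ,
    P.PosSemidef ∧ N.PosSemidef ∧
    symmetrization A = P - N ∧
    (∀ i, (P i i).re ≤ b ∧ (N i i).re ≤ b) ∧
    P.trace.re + N.trace.re ≤ t

/-- `(β, τ)`-decomposability of a tensor, imposed on each slice in the Fourier domain. -/
def TensorDecomposable {m n d : ℕ} (β τ : Fin d → ℝ) (A : Tensor m n d) : Prop :=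
  ∀ k, MatrixDecomposable (β k) (τ k) (fourierSlice A k)

/-- `(β, τ)`-decomposability of a set of tensors. -/
def SetDecomposable {m n d : ℕ} (β τ : Fin d → ℝ) (S : Set (Tensor m n d)) : Prop :=
  ∀ A ∈ S, TensorDecomposable β τ A

/-- What the adversary supplies in one round: an index triple and a loss function, of which only
the values on `[-1, 1]` matter. -/
structure Round (m n d : ℕ) where
  index : Fin m × Fin n × Fin d
  loss : ℝ → ℝ

/-- The entry of `A` at the index triple of the round `r`. -/
def Round.entry {m n d : ℕ} (r : Round m n d) (A : Tensor m n d) : ℝ :=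
  A r.index.1 r.index.2.1 r.index.2.2

/-- A round is admissible if its loss function is convex and `G`-Lipschitz on `[-1, 1]`. -/
def Round.Admissible {m n d : ℕ} (G : ℝ≥0) (r : Round m n d) : Prop :=
  ConvexOn ℝ (Set.Icc (-1) 1) r.loss ∧ LipschitzOnWith G r.loss (Set.Icc (-1) 1)

/-- A (deterministic) online algorithm: from the completed rounds, it determines the tensor that
it maintains in the next round, before it sees anything of that round. -/
abbrev Algorithm (m n d : ℕ) : Type := List (Round m n d) → Tensor m n d

/-- The tensor that the algorithm maintains in round `t` against the play `r` (rounds are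
numbered from zero). -/
def Algorithm.tensorAt {m n d T : ℕ} (alg : Algorithm m n d) (r : Fin T → Round m n d)
    (t : Fin T) : Tensor m n d :=
  alg ((List.ofFn r).take t)

/-- The regret of the algorithm against the play `r`, relative to the comparison set `S`. -/
def Algorithm.regret {m n d T : ℕ} (alg : Algorithm m n d) (S : Set (Tensor m n d))
    (r : Fin T → Round m n d) : ℝ :=
  ∑ t, (r t).loss ((r t).entry (alg.tensorAt r t)) -
    ⨅ U : S, ∑ t, (r t).loss ((r t).entry (U : Tensor m n d))

end OnlineTensor

end

/-! The learner runs follow-the-regularized-leader on linearized losses, in a lifted space: each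
Fourier slice is represented by a pair of positive semidefinite blocks whose difference has the
slice as its off-diagonal block, and `entryMap` recovers the tensor by the inverse transform. The
regularizer is von Neumann entropy on the blocks. Two facts carry the bound, with p = m + n. The
regularizer varies by at most D = log(2p) ∑ τ on the feasible set (`regularizer_sub_le`). It is also
strongly convex along every tensor entry, with gain s(1-s)(Δ entry)²/(4 ∑ β)
(`regularizer_strongly_convex`). For the latter, a strengthened Klein inequality bounds the
convexity gap of entropy below by squared Frobenius distances of matrix square roots
(`negEntropy_sub_ge`, `negEntropy_convex_gain`), and an off-diagonal entry of a matrix with diagonal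
at most b is Lipschitz in its square root, with squared constant 2b (`normSq_sub_apply_le`).
Cauchy–Schwarz over slices and signs then produces ∑ β. With learning rate η, the optimal
regularized value, as a potential, loses at most η (∑ β) G² per round, so the regret is at most D/η
+ η (∑ β) G² T. The choice of η that equalizes the two terms gives the theorem. -/

namespace OnlineTensor

open Matrix

/-! ### Frobenius norm. -/

section FrobeniusNorm

variable {ι : Type*} [Fintype ι]

/-- The squared Frobenius norm. -/
def frobSq (A : Matrix ι ι ℂ) : ℝ := ∑ i, ∑ j, Complex.normSq (A i j)

lemma frobSq_eq_trace {A : Matrix ι ι ℂ} (hA : A.IsHermitian) : frobSq A = (A * A).trace.re := by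
  rw [Matrix.trace, Complex.re_sum, frobSq]
  refine Finset.sum_congr rfl fun i _ => ?_
  rw [diag_apply, Matrix.mul_apply, Complex.re_sum]
  refine Finset.sum_congr rfl fun j _ => ?_
  rw [← hA.apply j i, Complex.star_def, Complex.mul_conj, Complex.ofReal_re]

end FrobeniusNorm

/-! ### Von Neumann entropy and a strengthened Klein inequality. -/

section MatrixEntropy

variable {ι : Type*} [Fintype ι] [DecidableEq ι]

/-- The squared moduli of the overlaps of the eigenvectors of two Hermitian matrices. -/
noncomputable def overlap {X Z : Matrix ι ι ℂ} (hX : X.IsHermitian) (hZ : Z.IsHermitian)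
    (a b : ι) : ℝ :=
  Complex.normSq ((star (hX.eigenvectorUnitary : Matrix ι ι ℂ) *
    (hZ.eigenvectorUnitary : Matrix ι ι ℂ)) a b)

lemma overlap_nonneg {X Z : Matrix ι ι ℂ} (hX : X.IsHermitian) (hZ : Z.IsHermitian) (a b : ι) :
    0 ≤ overlap hX hZ a b := Complex.normSq_nonneg _

lemma cfc_eq_mul_diagonal_mul {X : Matrix ι ι ℂ} (hX : X.IsHermitian) (f : ℝ → ℝ) :
    cfc f X = (hX.eigenvectorUnitary : Matrix ι ι ℂ) *
      diagonal (fun i => ((f (hX.eigenvalues i) : ℝ) : ℂ)) *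
        star (hX.eigenvectorUnitary : Matrix ι ι ℂ) := by
  rw [hX.cfc_eq, Matrix.IsHermitian.cfc, Unitary.conjStarAlgAut_apply]
  rfl

/-- The weights do not depend on `f` and `g` and are nonnegative, so trace inequalities between
functions of two noncommuting matrices reduce to scalar inequalities between eigenvalues. -/
lemma trace_cfc_mul_cfc {X Z : Matrix ι ι ℂ} (hX : X.IsHermitian) (hZ : Z.IsHermitian)
    (f g : ℝ → ℝ) :
    (cfc f X * cfc g Z).trace.re =
      ∑ a, ∑ b, overlap hX hZ a b * (f (hX.eigenvalues a) * g (hZ.eigenvalues b)) := by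
  rw [cfc_eq_mul_diagonal_mul hX, cfc_eq_mul_diagonal_mul hZ]
  set U : Matrix ι ι ℂ := (hX.eigenvectorUnitary : Matrix ι ι ℂ) with hU
  set V : Matrix ι ι ℂ := (hZ.eigenvectorUnitary : Matrix ι ι ℂ) with hV
  set D := diagonal (fun i => ((f (hX.eigenvalues i) : ℝ) : ℂ))
  set E := diagonal (fun i => ((g (hZ.eigenvalues i) : ℝ) : ℂ))
  have h1 : (U * D * star U * (V * E * star V)).trace =
      (D * (star U * V) * (E * star (star U * V))).trace := by
    rw [star_mul, star_star]
    simp only [Matrix.mul_assoc]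
    rw [trace_mul_comm U]
    simp only [Matrix.mul_assoc]
  rw [h1, Matrix.trace, Complex.re_sum]
  refine Finset.sum_congr rfl fun a _ => ?_
  rw [diag_apply, Matrix.mul_apply, Complex.re_sum]
  refine Finset.sum_congr rfl fun b _ => ?_
  rw [diagonal_mul, diagonal_mul, star_apply, overlap, ← hU, ← hV]
  have : ((f (hX.eigenvalues a) : ℝ) : ℂ) * (star U * V) a b *
      (((g (hZ.eigenvalues b) : ℝ) : ℂ) * star ((star U * V) a b)) =
      ((Complex.normSq ((star U * V) a b) *
        (f (hX.eigenvalues a) * g (hZ.eigenvalues b)) : ℝ) : ℂ) := by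
    push_cast
    rw [Complex.normSq_eq_conj_mul_self, starRingEnd_apply]
    ring
  rw [this, Complex.ofReal_re]

lemma trace_cfc {X : Matrix ι ι ℂ} (hX : X.IsHermitian) (f : ℝ → ℝ) :
    (cfc f X).trace.re = ∑ a, f (hX.eigenvalues a) := by
  rw [cfc_eq_mul_diagonal_mul hX, trace_mul_comm, ← Matrix.mul_assoc]
  simp [trace_diagonal]

lemma cfc_one_eq {X : Matrix ι ι ℂ} (hX : X.IsHermitian) :
    cfc (fun _ : ℝ => (1 : ℝ)) X = 1 := cfc_const_one ℝ X hX.isSelfAdjoint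

lemma cfc_self_eq {X : Matrix ι ι ℂ} (hX : X.IsHermitian) :
    cfc (fun x : ℝ => x) X = X := cfc_id' ℝ X hX.isSelfAdjoint

/-- The negative of the von Neumann entropy. -/
noncomputable def negEntropy (X : Matrix ι ι ℂ) : ℝ :=
  (cfc (fun x : ℝ => x * Real.log x) X).trace.re

/-- The square root of a positive semidefinite matrix. -/
noncomputable def msqrt (X : Matrix ι ι ℂ) : Matrix ι ι ℂ := cfc Real.sqrt X

lemma continuousOn_finite_spectrum {X : Matrix ι ι ℂ} (f : ℝ → ℝ) :
    ContinuousOn f (spectrum ℝ X) :=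
  (Matrix.finite_real_spectrum (A := X)).continuousOn f

lemma msqrt_isHermitian (X : Matrix ι ι ℂ) : (msqrt X).IsHermitian :=
  cfc_predicate (p := IsSelfAdjoint) Real.sqrt X

lemma msqrt_mul_self {X : Matrix ι ι ℂ} (hX : X.PosSemidef) : msqrt X * msqrt X = X := by
  have hs := hX.isHermitian.isSelfAdjoint
  rw [msqrt, ← cfc_mul Real.sqrt Real.sqrt X (continuousOn_finite_spectrum _)
    (continuousOn_finite_spectrum _)]
  conv_rhs => rw [← cfc_self_eq hX.isHermitian]
  refine cfc_congr fun x hx => ?_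
  rw [hX.isHermitian.spectrum_real_eq_range_eigenvalues] at hx
  obtain ⟨i, rfl⟩ := hx
  exact Real.mul_self_sqrt (hX.eigenvalues_nonneg i)

lemma frobSq_msqrt_sub {X Z : Matrix ι ι ℂ} (hX : X.PosSemidef) (hZ : Z.PosSemidef) :
    frobSq (msqrt X - msqrt Z) =
      X.trace.re + Z.trace.re - 2 * (msqrt X * msqrt Z).trace.re := by
  rw [frobSq_eq_trace ((msqrt_isHermitian X).sub (msqrt_isHermitian Z))]
  rw [sub_mul, mul_sub, mul_sub, msqrt_mul_self hX, msqrt_mul_self hZ]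
  simp only [trace_sub, Complex.sub_re]
  rw [trace_mul_comm (msqrt Z)]
  ring

/-- Equivalent to x log(x/z) - x + z ≥ (√x - √z)²; it is log y ≤ y - 1 at y = √z/√x. -/
lemma mul_log_ge {x z : ℝ} (hx : 0 ≤ x) (hz : 0 < z) :
    0 ≤ x * Real.log x - x * Real.log z - 2 * x + 2 * (√x * √z) := by
  rcases hx.eq_or_lt with rfl | hx
  · simp
  have h1 := Real.log_le_sub_one_of_pos (div_pos (Real.sqrt_pos.2 hz) (Real.sqrt_pos.2 hx))
  rw [Real.log_div (Real.sqrt_pos.2 hz).ne' (Real.sqrt_pos.2 hx).ne', Real.log_sqrt hz.le,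
    Real.log_sqrt hx.le] at h1
  have h2 : x * (√z / √x) = √x * √z := by
    have := Real.mul_self_sqrt hx.le
    field_simp
    nlinarith
  have := mul_le_mul_of_nonneg_left h1 hx.le
  rw [mul_sub, mul_sub, h2] at this
  linarith

/-- For a spectral projection π of `Z`, Tr(Mπ) = Tr(πMπ). -/
lemma trace_mul_cfc_indicator_nonneg {M : Matrix ι ι ℂ} (hM : M.PosSemidef) (Z : Matrix ι ι ℂ)
    (t : Set ℝ) : 0 ≤ (M * cfc (t.indicator (fun _ => (1 : ℝ))) Z).trace.re := by
  set π := cfc (t.indicator (fun _ => (1 : ℝ))) Z with hπ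
  have hsa : π.conjTranspose = π := cfc_predicate (p := IsSelfAdjoint) _ Z
  have hidem : π * π = π := by
    rw [hπ, ← cfc_mul _ _ Z (continuousOn_finite_spectrum _) (continuousOn_finite_spectrum _)]
    congr 1
    ext x
    by_cases hx : x ∈ t <;> simp [hx]
  have h := (hM.conjTranspose_mul_mul_same π).trace_nonneg
  rw [hsa, Matrix.mul_assoc, trace_mul_comm, Matrix.mul_assoc, hidem] at h
  exact (Complex.le_def.1 h).1

/-- The kernel of `Z` lies in that of `X`: with π the projection onto the kernel of `Z`, 0 ≤ Tr((Z -
sX)π) = -s Tr(Xπ), and Tr(Xπ) is a sum of nonnegative terms. -/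
lemma overlap_mul_eigenvalue_eq_zero {X Z : Matrix ι ι ℂ} (hX : X.PosSemidef) (hZ : Z.PosSemidef)
    {s : ℝ} (hs : 0 < s) (hXZ : (Z - s • X).PosSemidef) (a b : ι)
    (hb : hZ.isHermitian.eigenvalues b = 0) :
    overlap hX.isHermitian hZ.isHermitian a b * hX.isHermitian.eigenvalues a = 0 := by
  have h1 := trace_mul_cfc_indicator_nonneg hXZ Z {0}
  have h2 : Z * cfc (({0} : Set ℝ).indicator (fun _ => (1 : ℝ))) Z = 0 := by
    conv_lhs => enter [1]; rw [← cfc_self_eq hZ.isHermitian]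
    rw [← cfc_mul _ _ Z (continuousOn_finite_spectrum _) (continuousOn_finite_spectrum _),
      ← cfc_const_zero ℝ Z]
    congr 1
    ext x
    by_cases hx : x = 0 <;> simp [hx]
  have h3 := trace_cfc_mul_cfc hX.isHermitian hZ.isHermitian (fun x => x)
    (({0} : Set ℝ).indicator (fun _ => (1 : ℝ)))
  rw [cfc_self_eq hX.isHermitian] at h3
  rw [sub_mul, h2, smul_mul_assoc, zero_sub, trace_neg, trace_smul, Complex.neg_re,
    Complex.real_smul, Complex.re_ofReal_mul, h3] at h1
  have hnn : ∀ i j, 0 ≤ overlap hX.isHermitian hZ.isHermitian i j *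
      (hX.isHermitian.eigenvalues i *
        ({0} : Set ℝ).indicator (fun _ => (1 : ℝ)) (hZ.isHermitian.eigenvalues j)) :=
    fun i j => mul_nonneg (overlap_nonneg _ _ _ _) (mul_nonneg (hX.eigenvalues_nonneg i)
      (Set.indicator_nonneg (fun _ _ => zero_le_one) _))
  have h4 := Finset.single_le_sum (f := fun i => ∑ j, _)
    (fun i _ => Finset.sum_nonneg fun j _ => hnn i j) (Finset.mem_univ a)
  have h5 := Finset.single_le_sum (fun j _ => hnn a j) (Finset.mem_univ b)
  have h6 := (h5.trans h4).trans (nonpos_of_mul_nonneg_right (by linarith) (neg_neg_of_pos hs))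
  rw [hb] at h6
  simp only [Set.mem_singleton_iff, Set.indicator_of_mem, mul_one] at h6
  exact le_antisymm h6 (mul_nonneg (overlap_nonneg _ _ _ _) (hX.eigenvalues_nonneg a))

/-- A quantitative form of Klein's inequality. -/
lemma negEntropy_sub_ge {X Z : Matrix ι ι ℂ} (hX : X.PosSemidef) (hZ : Z.PosSemidef) {s : ℝ}
    (hs : 0 < s) (hXZ : (Z - s • X).PosSemidef) :
    frobSq (msqrt X - msqrt Z) + X.trace.re - Z.trace.re ≤
      negEntropy X - (X * cfc Real.log Z).trace.re := by
  have hXh := hX.isHermitian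
  have hZh := hZ.isHermitian
  have e1 := trace_cfc_mul_cfc hXh hZh (fun x => x * Real.log x) (fun _ => 1)
  rw [cfc_one_eq hZh, mul_one] at e1
  have e2 := trace_cfc_mul_cfc hXh hZh (fun x => x) Real.log
  rw [cfc_self_eq hXh] at e2
  have e3 := trace_cfc_mul_cfc hXh hZh (fun x => x) (fun _ => 1)
  rw [cfc_self_eq hXh, cfc_one_eq hZh, mul_one] at e3
  have e4 := trace_cfc_mul_cfc hXh hZh Real.sqrt Real.sqrt
  -- Since `Real.log 0 = 0`, the scalar inequality can fail at a zero eigenvalue of `Z`; there the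
  -- weighted terms vanish instead.
  have key : ∀ a b, hZh.eigenvalues b = 0 → overlap hXh hZh a b * hXh.eigenvalues a = 0 := by
    intro a b hb
    exact overlap_mul_eigenvalue_eq_zero hX hZ hs hXZ a b hb
  rw [frobSq_msqrt_sub hX hZ, negEntropy, msqrt, msqrt, e1, e2, e4, e3]
  have : 0 ≤ ∑ a, ∑ b, overlap hXh hZh a b *
      (hXh.eigenvalues a * Real.log (hXh.eigenvalues a) -
        hXh.eigenvalues a * Real.log (hZh.eigenvalues b) - 2 * hXh.eigenvalues a +
        2 * (√(hXh.eigenvalues a) * √(hZh.eigenvalues b))) := by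
    refine Finset.sum_nonneg fun a _ => Finset.sum_nonneg fun b _ => ?_
    rcases (hZ.eigenvalues_nonneg b).eq_or_lt with hb | hb
    · have := key a b hb.symm
      rw [← hb]
      simp only [Real.log_zero, Real.sqrt_zero]
      apply le_of_eq
      linear_combination (2 - Real.log (hXh.eigenvalues a)) * this
    · exact mul_nonneg (overlap_nonneg _ _ _ _) (mul_log_ge (hX.eigenvalues_nonneg a) hb)
  have h2 : ∑ a, ∑ b, overlap hXh hZh a b *
      (hXh.eigenvalues a * Real.log (hXh.eigenvalues a) -
        hXh.eigenvalues a * Real.log (hZh.eigenvalues b) - 2 * hXh.eigenvalues a +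
        2 * (√(hXh.eigenvalues a) * √(hZh.eigenvalues b))) =
      ∑ a, ∑ b, overlap hXh hZh a b *
        (hXh.eigenvalues a * Real.log (hXh.eigenvalues a) * 1) -
      ∑ a, ∑ b, overlap hXh hZh a b * (hXh.eigenvalues a * Real.log (hZh.eigenvalues b)) -
      2 * ∑ a, ∑ b, overlap hXh hZh a b * (hXh.eigenvalues a * 1) +
      2 * ∑ a, ∑ b, overlap hXh hZh a b * (√(hXh.eigenvalues a) * √(hZh.eigenvalues b)) := by
    simp only [Finset.mul_sum, ← Finset.sum_sub_distrib, ← Finset.sum_add_distrib]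
    refine Finset.sum_congr rfl fun a _ => Finset.sum_congr rfl fun b _ => ?_
    ring
  rw [h2] at this
  linarith

/-- Convexity of the negative entropy with an explicit quadratic gain. -/
lemma negEntropy_convex_gain {X Y : Matrix ι ι ℂ} (hX : X.PosSemidef) (hY : Y.PosSemidef) {s : ℝ}
    (hs : 0 < s) (hs1 : s < 1) :
    negEntropy ((1 - s) • X + s • Y) +
        (1 - s) * frobSq (msqrt X - msqrt ((1 - s) • X + s • Y)) +
        s * frobSq (msqrt Y - msqrt ((1 - s) • X + s • Y)) ≤
      (1 - s) * negEntropy X + s * negEntropy Y := by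
  have hs' : 0 < 1 - s := by linarith
  have hX' : ((1 - s) • X).PosSemidef := hX.smul hs'.le
  have hY' : (s • Y).PosSemidef := hY.smul hs.le
  have hZ := hX'.add hY'
  -- Both endpoints are compared with the mixture `Z`. In the weighted sum the trace terms cancel,
  -- and the terms with log Z add up to the entropy term of `Z`.
  have h1 := negEntropy_sub_ge hX hZ hs' (by simpa using hY')
  have h2 := negEntropy_sub_ge hY hZ hs (by simpa using hX')
  set Z := (1 - s) • X + s • Y with hZdef
  have h3 : negEntropy Z = (Z * cfc Real.log Z).trace.re := by
    rw [negEntropy, cfc_mul (fun x : ℝ => x) Real.log Z (continuousOn_finite_spectrum _)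
      (continuousOn_finite_spectrum _), cfc_self_eq hZ.isHermitian]
  have h4 : (Z * cfc Real.log Z).trace.re = (1 - s) * (X * cfc Real.log Z).trace.re +
      s * (Y * cfc Real.log Z).trace.re := by
    conv_lhs => enter [1, 1, 1]; rw [hZdef]
    simp [add_mul, trace_add, trace_smul]
  have h5 : Z.trace.re = (1 - s) * X.trace.re + s * Y.trace.re := by
    rw [hZdef]; simp [trace_add, trace_smul]
  have g1 := mul_le_mul_of_nonneg_left h1 hs'.le
  have g2 := mul_le_mul_of_nonneg_left h2 hs.le
  rw [h3, h4]
  nlinarith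

end MatrixEntropy

lemma normSq_apply_comm {ι : Type*} {A : Matrix ι ι ℂ} (hA : A.IsHermitian)
    (i j : ι) : Complex.normSq (A i j) = Complex.normSq (A j i) := by
  rw [← hA.apply i j, Complex.star_def, Complex.normSq_conj]

/-! ### Entries of a matrix in terms of its square root. -/

section EntryBounds

variable {ι : Type*} [Fintype ι] [DecidableEq ι]

lemma normSq_sum_mul_le {ι : Type*} [Fintype ι] (u v : ι → ℂ) :
    Complex.normSq (∑ l, u l * v l) ≤
      (∑ l, Complex.normSq (u l)) * ∑ l, Complex.normSq (v l) := by
  simp only [Complex.normSq_eq_norm_sq]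
  refine le_trans ?_ (Finset.sum_mul_sq_le_sq_mul_sq _ _ _)
  gcongr
  refine (norm_sum_le _ _).trans_eq ?_
  simp

lemma normSq_add_le (p q : ℂ) :
    Complex.normSq (p + q) ≤ 2 * (Complex.normSq p + Complex.normSq q) := by
  simp only [Complex.normSq_apply, Complex.add_re, Complex.add_im]
  nlinarith [sq_nonneg (p.re - q.re), sq_nonneg (p.im - q.im)]

lemma sum_normSq_msqrt_row {X : Matrix ι ι ℂ} (hX : X.PosSemidef) (i : ι) :
    ∑ l, Complex.normSq (msqrt X i l) = (X i i).re := by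
  conv_rhs => rw [← msqrt_mul_self hX, Matrix.mul_apply, Complex.re_sum]
  refine Finset.sum_congr rfl fun j _ => ?_
  rw [← (msqrt_isHermitian X).apply j i, Complex.star_def, Complex.mul_conj, Complex.ofReal_re]

lemma normSq_apply_le {X : Matrix ι ι ℂ} (hX : X.PosSemidef) (i j : ι) :
    Complex.normSq (X i j) ≤ (X i i).re * (X j j).re := by
  rw [← sum_normSq_msqrt_row hX, ← sum_normSq_msqrt_row hX]
  conv_lhs => rw [← msqrt_mul_self hX, Matrix.mul_apply]
  refine (normSq_sum_mul_le _ _).trans_eq ?_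
  congr 1
  exact Finset.sum_congr rfl fun l _ => normSq_apply_comm (msqrt_isHermitian X) l j

/-- Off-diagonal entries depend on the matrix square root in a Lipschitz way, with a constant
determined by the diagonal. -/
lemma normSq_sub_apply_le {X Z : Matrix ι ι ℂ} (hX : X.PosSemidef) (hZ : Z.PosSemidef) {b : ℝ}
    (hXb : ∀ i, (X i i).re ≤ b) (hZb : ∀ i, (Z i i).re ≤ b) {i j : ι} (hij : i ≠ j) :
    Complex.normSq (X i j - Z i j) ≤ 2 * b * frobSq (msqrt X - msqrt Z) := by
  set S := msqrt X + msqrt Z with hS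
  set D := msqrt X - msqrt Z with hD
  have hSh : S.IsHermitian := (msqrt_isHermitian X).add (msqrt_isHermitian Z)
  have hDh : D.IsHermitian := (msqrt_isHermitian X).sub (msqrt_isHermitian Z)
  have hb : 0 ≤ b := le_trans (Complex.le_def.1 (hX.diag_nonneg (i := i))).1 (hXb i)
  have hrow : ∀ i, ∑ l, Complex.normSq (S i l) ≤ 4 * b := by
    intro i
    calc ∑ l, Complex.normSq (S i l)
        ≤ ∑ l, 2 * (Complex.normSq (msqrt X i l) + Complex.normSq (msqrt Z i l)) :=
          Finset.sum_le_sum fun l _ => normSq_add_le _ _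
      _ = 2 * ((X i i).re + (Z i i).re) := by
          rw [← Finset.mul_sum, Finset.sum_add_distrib, sum_normSq_msqrt_row hX,
            sum_normSq_msqrt_row hZ]
      _ ≤ 4 * b := by linarith [hXb i, hZb i]
  have hDnn : ∀ i, 0 ≤ ∑ l, Complex.normSq (D i l) :=
    fun i => Finset.sum_nonneg fun l _ => Complex.normSq_nonneg _
  -- Noncommutative difference of squares. Rows of `S` have squared norm at most 4b, because a row
  -- of the square root has the diagonal entry as its squared norm.
  have e : X - Z = (2⁻¹ : ℂ) • (S * D + D * S) := by
    have : S * D + D * S = (2 : ℂ) • (X - Z) := by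
      conv_rhs => rw [← msqrt_mul_self hX, ← msqrt_mul_self hZ]
      rw [hS, hD, two_smul]
      noncomm_ring
    rw [this, smul_smul]
    norm_num
  have e' : X i j - Z i j = (2⁻¹ : ℂ) * ((S * D) i j + (D * S) i j) := by
    have := congrFun (congrFun e i) j
    simpa using this
  have h1 : Complex.normSq ((S * D) i j) ≤ 4 * b * ∑ l, Complex.normSq (D j l) := by
    rw [Matrix.mul_apply]
    refine (normSq_sum_mul_le _ _).trans ?_
    simp only [normSq_apply_comm hDh _ j]
    exact mul_le_mul_of_nonneg_right (hrow i) (hDnn j)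
  have h2 : Complex.normSq ((D * S) i j) ≤ 4 * b * ∑ l, Complex.normSq (D i l) := by
    rw [Matrix.mul_apply]
    refine (normSq_sum_mul_le _ _).trans ?_
    simp only [normSq_apply_comm hSh _ j]
    rw [mul_comm]
    exact mul_le_mul_of_nonneg_right (hrow j) (hDnn i)
  -- As i ≠ j, these are different rows, so `frobSq D` is counted only once.
  have h3 : ∑ l, Complex.normSq (D i l) + ∑ l, Complex.normSq (D j l) ≤ frobSq D := by
    rw [frobSq, ← Finset.sum_pair (f := fun i => ∑ l, Complex.normSq (D i l)) hij]
    exact Finset.sum_le_sum_of_subset_of_nonneg (Finset.subset_univ _) fun i _ _ => hDnn i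
  rw [e', Complex.normSq_mul]
  have h4 := normSq_add_le ((S * D) i j) ((D * S) i j)
  have h5 : Complex.normSq (2⁻¹ : ℂ) = 1 / 4 := by
    rw [Complex.normSq_inv, Complex.normSq_ofNat]; norm_num
  rw [h5]
  have h6 := mul_le_mul_of_nonneg_left h3 hb
  linarith

end EntryBounds

/-! ### Range and continuity of the entropy. -/

section EntropyBounds

variable {ι : Type*} [Fintype ι] [DecidableEq ι]

lemma trace_re_eq_sum_eigenvalues {X : Matrix ι ι ℂ} (hX : X.IsHermitian) :
    X.trace.re = ∑ i, hX.eigenvalues i := by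
  rw [hX.trace_eq_sum_eigenvalues, Complex.re_sum]
  rfl

lemma eigenvalues_le_trace {X : Matrix ι ι ℂ} (hX : X.PosSemidef) (i : ι) :
    hX.isHermitian.eigenvalues i ≤ X.trace.re := by
  rw [trace_re_eq_sum_eigenvalues hX.isHermitian]
  exact Finset.single_le_sum (fun j _ => hX.eigenvalues_nonneg j) (Finset.mem_univ i)

lemma negEntropy_le {X : Matrix ι ι ℂ} (hX : X.PosSemidef) {t : ℝ} (ht : X.trace.re ≤ t) :
    negEntropy X ≤ X.trace.re * Real.log t := by
  rw [negEntropy, trace_cfc hX.isHermitian]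
  conv_rhs => rw [trace_re_eq_sum_eigenvalues hX.isHermitian, Finset.sum_mul]
  refine Finset.sum_le_sum fun i _ => ?_
  rcases (hX.eigenvalues_nonneg i).eq_or_lt with h | h
  · simp [← h]
  · exact mul_le_mul_of_nonneg_left
      (Real.log_le_log h ((eigenvalues_le_trace hX i).trans ht)) h.le

/-- The tangent to x log x at t/q lies below it; summed over the eigenvalues. -/
lemma le_negEntropy {X : Matrix ι ι ℂ} (hX : X.PosSemidef) {t q : ℝ} (ht : X.trace.re ≤ t)
    (hq : 0 < q) :
    (Real.log (t / q) + 1) * X.trace.re - Fintype.card ι * (t / q) ≤ negEntropy X := by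
  rw [negEntropy, trace_cfc hX.isHermitian]
  have e : (Real.log (t / q) + 1) * X.trace.re - Fintype.card ι * (t / q) =
      ∑ i, ((Real.log (t / q) + 1) * hX.isHermitian.eigenvalues i - t / q) := by
    rw [trace_re_eq_sum_eigenvalues hX.isHermitian, Finset.sum_sub_distrib, Finset.mul_sum]
    simp
  rw [e]
  refine Finset.sum_le_sum fun i _ => ?_
  have h0 := hX.eigenvalues_nonneg i
  have h1 := (eigenvalues_le_trace hX i).trans ht
  set x := hX.isHermitian.eigenvalues i
  rcases (h0.trans h1).eq_or_lt with h | h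
  · have : x = 0 := by linarith
    simp [this, ← h]
  · have hc : 0 < t / q := div_pos h hq
    rcases h0.eq_or_lt with h0 | h0
    · rw [← h0]; simp; linarith
    · have h2 := Real.log_le_sub_one_of_pos (div_pos hc h0)
      rw [Real.log_div hc.ne' h0.ne'] at h2
      have h3 := mul_le_mul_of_nonneg_left h2 h0.le
      have h4 : x * (t / q / x - 1) = t / q - x := by field_simp
      rw [h4] at h3
      linarith

open scoped Matrix.Norms.L2Operator in
lemma continuousOn_cfc_matrix (f : ℝ → ℝ) (hf : Continuous f) (t : ℝ) :
    ContinuousOn (fun X : Matrix ι ι ℂ => cfc f X)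
      {X | X.IsHermitian ∧ spectrum ℝ X ⊆ Set.Icc 0 t} :=
  continuousOn_cfc (Matrix ι ι ℂ) isCompact_Icc f hf.continuousOn

/-- The trace bound confines all spectra to one compact interval, on which the functional calculus
is continuous in the matrix. -/
lemma continuousOn_negEntropy (t : ℝ) :
    ContinuousOn (negEntropy (ι := ι)) {X | X.PosSemidef ∧ X.trace.re ≤ t} := by
  have h := continuousOn_cfc_matrix (ι := ι) _ Real.continuous_mul_log t
  refine Complex.continuous_re.comp_continuousOn
    ((Continuous.matrix_trace continuous_id).comp_continuousOn (h.mono ?_))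
  rintro X ⟨hX, ht⟩
  refine ⟨hX.isHermitian, ?_⟩
  rw [hX.isHermitian.spectrum_real_eq_range_eigenvalues]
  rintro _ ⟨i, rfl⟩
  exact ⟨hX.eigenvalues_nonneg i, (eigenvalues_le_trace hX i).trans ht⟩

end EntropyBounds

lemma isClosed_posSemidef {ι : Type*} [Fintype ι] :
    IsClosed {X : Matrix ι ι ℂ | X.PosSemidef} := by
  have : {X : Matrix ι ι ℂ | X.PosSemidef} =
      {X | X.conjTranspose = X} ∩ ⋂ x : ι → ℂ, {X | 0 ≤ star x ⬝ᵥ X *ᵥ x} := by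
    ext X
    simp [Matrix.posSemidef_iff_dotProduct_mulVec, Matrix.IsHermitian]
  rw [this]
  refine (isClosed_eq (by fun_prop) continuous_id).inter (isClosed_iInter fun x => ?_)
  exact isClosed_le continuous_const (by fun_prop)

/-! ### Inversion of the discrete Fourier transform. -/

section Fourier

lemma sum_exp_mul_exp {d : ℕ} (l l' : Fin d) :
    ∑ k : Fin d,
      Complex.exp (-(2 * (Real.pi : ℂ) * Complex.I * ((k : ℕ) : ℂ) * ((l' : ℕ) : ℂ) / (d : ℂ))) *
      Complex.exp (2 * (Real.pi : ℂ) * Complex.I * ((k : ℕ) : ℂ) * ((l : ℕ) : ℂ) / (d : ℂ)) =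
    if l = l' then (d : ℂ) else 0 := by
  have hd : d ≠ 0 := by have := l.isLt; omega
  have hζ := Complex.isPrimitiveRoot_exp d hd
  set ζ := Complex.exp (2 * (Real.pi : ℂ) * Complex.I / (d : ℂ)) with hζdef
  have hζ0 : ζ ≠ 0 := Complex.exp_ne_zero _
  have hterm : ∀ k : Fin d,
      Complex.exp (-(2 * (Real.pi : ℂ) * Complex.I * ((k : ℕ) : ℂ) * ((l' : ℕ) : ℂ) / (d : ℂ))) *
      Complex.exp (2 * (Real.pi : ℂ) * Complex.I * ((k : ℕ) : ℂ) * ((l : ℕ) : ℂ) / (d : ℂ)) =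
      (ζ ^ (l : ℕ) / ζ ^ (l' : ℕ)) ^ (k : ℕ) := by
    intro k
    rw [hζdef, ← Complex.exp_nat_mul, ← Complex.exp_nat_mul, ← Complex.exp_sub,
      ← Complex.exp_nat_mul, ← Complex.exp_add]
    congr 1
    ring
  simp only [hterm]
  -- A geometric sum whose ratio is a `d`-th root of unity, equal to 1 only if l = l'.
  rw [Fin.sum_univ_eq_sum_range (fun k => (ζ ^ (l : ℕ) / ζ ^ (l' : ℕ)) ^ k)]
  split_ifs with h
  · subst h
    simp [div_self (pow_ne_zero _ hζ0)]
  · have hne : ζ ^ (l : ℕ) / ζ ^ (l' : ℕ) ≠ 1 := by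
      intro he
      rw [div_eq_one_iff_eq (pow_ne_zero _ hζ0)] at he
      exact h (Fin.ext (hζ.pow_inj l.isLt l'.isLt he))
    rw [geom_sum_eq hne, div_pow, ← pow_mul, ← pow_mul, mul_comm, pow_mul, mul_comm (l' : ℕ),
      pow_mul, hζ.pow_eq_one]
    simp

/-- Inversion of the unitary discrete Fourier transform. -/
lemma fourierSlice_inversion {m n d : ℕ} (A : Tensor m n d) (i : Fin m) (j : Fin n) (l : Fin d) :
    ((1 / Real.sqrt (d : ℝ) : ℝ) : ℂ) * ∑ k : Fin d, fourierSlice A k i j *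
      Complex.exp (2 * (Real.pi : ℂ) * Complex.I * ((k : ℕ) : ℂ) * ((l : ℕ) : ℂ) / (d : ℂ)) =
    (A i j l : ℂ) := by
  have hd : (0 : ℝ) < d := by have := l.isLt; exact_mod_cast (by omega : 0 < d)
  have hdc : (d : ℂ) ≠ 0 := by exact_mod_cast hd.ne'
  have hsq : ((1 / Real.sqrt (d : ℝ) : ℝ) : ℂ) * ((1 / Real.sqrt (d : ℝ) : ℝ) : ℂ) =
      1 / (d : ℂ) := by
    rw [← Complex.ofReal_mul, div_mul_div_comm, Real.mul_self_sqrt hd.le]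
    simp
  simp only [fourierSlice, Matrix.of_apply, mul_assoc (((1 / Real.sqrt (d : ℝ) : ℝ) : ℂ)),
    Finset.sum_mul]
  rw [← Finset.mul_sum, ← mul_assoc, hsq, Finset.sum_comm]
  have : ∀ l' : Fin d, ∑ k : Fin d, (A i j l' : ℂ) *
      Complex.exp (-(2 * (Real.pi : ℂ) * Complex.I * ((k : ℕ) : ℂ) * ((l' : ℕ) : ℂ) / (d : ℂ))) *
      Complex.exp (2 * (Real.pi : ℂ) * Complex.I * ((k : ℕ) : ℂ) * ((l : ℕ) : ℂ) / (d : ℂ)) =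
      (A i j l' : ℂ) * if l = l' then (d : ℂ) else 0 := by
    intro l'
    rw [← sum_exp_mul_exp, Finset.mul_sum]
    exact Finset.sum_congr rfl fun k _ => mul_assoc _ _ _
  simp only [this]
  simp [Finset.sum_ite_eq]
  field_simp

end Fourier

/-! ### The lifted feasible set and its regularizer. -/

section Blocks

variable {m n d : ℕ}

/-- Pairs of square matrices of dimension `m + n`, one pair for each frontal slice. -/
abbrev Blocks (m n d : ℕ) : Type :=
  Fin d → Bool → Matrix (Fin m ⊕ Fin n) (Fin m ⊕ Fin n) ℂ

/-- The tensor whose Fourier slices are represented by differences of blocks. -/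
noncomputable def entryMap : Blocks m n d →ₗ[ℝ] Tensor m n d where
  -- Arbitrary blocks need not be conjugate symmetric in `k`, hence the real part.
  toFun X i j l := (((1 / Real.sqrt (d : ℝ) : ℝ) : ℂ) * ∑ k : Fin d,
    (X k true (Sum.inl i) (Sum.inr j) - X k false (Sum.inl i) (Sum.inr j)) *
      Complex.exp (2 * (Real.pi : ℂ) * Complex.I * ((k : ℕ) : ℂ) * ((l : ℕ) : ℂ) / (d : ℂ))).re
  map_add' X Y := by
    ext i j l
    simp only [Pi.add_apply, Matrix.add_apply]
    rw [← Complex.add_re, ← mul_add, ← Finset.sum_add_distrib]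
    congr 3
    ext k
    ring
  map_smul' c X := by
    ext i j l
    simp only [Pi.smul_apply, Matrix.smul_apply, smul_eq_mul, RingHom.id_apply]
    rw [← Complex.re_ofReal_mul, mul_left_comm (c : ℂ), Finset.mul_sum _ _ (c : ℂ)]
    congr 3
    ext k
    simp only [Complex.real_smul]
    ring

lemma continuous_entryMap : Continuous (entryMap (m := m) (n := n) (d := d)) := by
  unfold entryMap
  simp only [LinearMap.coe_mk, AddHom.coe_mk]
  fun_prop

lemma sq_entryMap_le (X : Blocks m n d) (i : Fin m) (j : Fin n) (l : Fin d) :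
    (entryMap X i j l) ^ 2 ≤
      (∑ p : Fin d × Bool, ‖X p.1 p.2 (Sum.inl i) (Sum.inr j)‖) ^ 2 := by
  refine sq_le_sq.2 ?_
  rw [abs_of_nonneg (a := ∑ p : Fin d × Bool, _) (Finset.sum_nonneg fun _ _ => norm_nonneg _)]
  refine (Complex.abs_re_le_norm _).trans ?_
  have hd : (1 : ℝ) ≤ Real.sqrt d := by
    rw [Real.one_le_sqrt]
    have := l.isLt
    exact_mod_cast (by omega : 1 ≤ d)
  have h1 : ‖((1 / Real.sqrt (d : ℝ) : ℝ) : ℂ)‖ ≤ 1 := by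
    rw [Complex.norm_real, Real.norm_of_nonneg (by positivity)]
    exact div_le_one_of_le₀ hd (by positivity)
  -- The factor 1/√d is only bounded by 1.
  rw [norm_mul]
  refine (mul_le_of_le_one_left (norm_nonneg _) h1).trans ((norm_sum_le _ _).trans ?_)
  rw [Fintype.sum_prod_type]
  refine Finset.sum_le_sum fun k _ => ?_
  have h2 : ‖Complex.exp (2 * (Real.pi : ℂ) * Complex.I * ((k : ℕ) : ℂ) * ((l : ℕ) : ℂ) /
      (d : ℂ))‖ = 1 := by
    have : 2 * (Real.pi : ℂ) * Complex.I * ((k : ℕ) : ℂ) * ((l : ℕ) : ℂ) / (d : ℂ) =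
        ((2 * Real.pi * k * l / d : ℝ) : ℂ) * Complex.I := by push_cast; ring
    rw [this, Complex.norm_exp_ofReal_mul_I]
  rw [norm_mul, h2, mul_one, Fintype.sum_bool]
  exact norm_sub_le _ _

/-- The feasible blocks. -/
def feasible (β τ : Fin d → ℝ) (S : Set (Tensor m n d)) : Set (Blocks m n d) :=
  {X | (∀ k b, (X k b).PosSemidef) ∧ (∀ k b i, (X k b i i).re ≤ β k) ∧
    (∀ k, (X k true).trace.re + (X k false).trace.re ≤ τ k) ∧
    -- Makes every feasible point a legal tensor for the learner, so predictions stay in [-1, 1]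
    -- when `S` is in the box.
    entryMap X ∈ closure (convexHull ℝ S)}

variable {β τ : Fin d → ℝ} {S : Set (Tensor m n d)}

lemma exists_feasible_entryMap_eq (hdec : SetDecomposable β τ S) {U : Tensor m n d}
    (hU : U ∈ S) : ∃ X ∈ feasible β τ S, entryMap X = U := by
  choose P N hP hN hPN hdiag htr using hdec U hU
  have e : entryMap (fun k b => if b then P k else N k) = U := by
    ext i j l
    have h : ∀ k, P k (Sum.inl i) (Sum.inr j) - N k (Sum.inl i) (Sum.inr j) =
        fourierSlice U k i j := by
      intro k
      have := congrFun (congrFun (hPN k) (Sum.inl i)) (Sum.inr j)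
      simpa [symmetrization] using this.symm
    have := congrArg Complex.re (fourierSlice_inversion U i j l)
    simp only [← h, Complex.ofReal_re] at this
    simpa [entryMap] using this
  refine ⟨fun k b => if b then P k else N k, ⟨?_, ?_, ?_, ?_⟩, e⟩
  · rintro k (_ | _)
    · exact hN k
    · exact hP k
  · rintro k (_ | _) i
    · exact (hdiag k i).2
    · exact (hdiag k i).1
  · exact htr
  · rw [e]
    exact subset_closure (subset_convexHull ℝ S hU)

lemma convex_feasible : Convex ℝ (feasible β τ S) := by
  rintro X ⟨h1, h2, h3, h4⟩ Y ⟨g1, g2, g3, g4⟩ a b ha hb hab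
  refine ⟨fun k c => ?_, fun k c i => ?_, fun k => ?_, ?_⟩
  · exact ((h1 k c).smul ha).add ((g1 k c).smul hb)
  · have e1 := mul_le_mul_of_nonneg_left (h2 k c i) ha
    have e2 := mul_le_mul_of_nonneg_left (g2 k c i) hb
    simp only [Pi.add_apply, Pi.smul_apply, Matrix.add_apply, Matrix.smul_apply, Complex.add_re,
      Complex.real_smul, Complex.re_ofReal_mul]
    calc _ ≤ a * β k + b * β k := by linarith
      _ = β k := by rw [← add_mul, hab, one_mul]
  · have e1 := mul_le_mul_of_nonneg_left (h3 k) ha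
    have e2 := mul_le_mul_of_nonneg_left (g3 k) hb
    simp only [Pi.add_apply, Pi.smul_apply, trace_add, trace_smul, Complex.add_re,
      Complex.real_smul, Complex.re_ofReal_mul]
    calc _ ≤ a * τ k + b * τ k := by linarith
      _ = τ k := by rw [← add_mul, hab, one_mul]
  · rw [map_add, map_smul, map_smul]
    exact (convex_convexHull ℝ S).closure h4 g4 ha hb hab

lemma trace_re_nonneg {ι : Type*} [Fintype ι] {X : Matrix ι ι ℂ} (hX : X.PosSemidef) :
    0 ≤ X.trace.re := (Complex.le_def.1 hX.trace_nonneg).1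

lemma trace_le_of_feasible {X : Blocks m n d} (hX : X ∈ feasible β τ S) (k : Fin d) (b : Bool) :
    (X k b).trace.re ≤ τ k := by
  obtain ⟨h1, -, h3, -⟩ := hX
  have h4 := trace_re_nonneg (h1 k true)
  have h5 := trace_re_nonneg (h1 k false)
  rcases b with _ | _ <;> linarith [h3 k]

lemma isCompact_feasible : IsCompact (feasible β τ S) := by
  have hc : IsClosed (feasible β τ S) := by
    have : feasible β τ S = (⋂ k, ⋂ b, (fun X : Blocks m n d => X k b) ⁻¹' {M | M.PosSemidef}) ∩
        ((⋂ k, ⋂ b, ⋂ i, {X : Blocks m n d | (X k b i i).re ≤ β k}) ∩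
        ((⋂ k, {X : Blocks m n d | (X k true).trace.re + (X k false).trace.re ≤ τ k}) ∩
        entryMap ⁻¹' closure (convexHull ℝ S))) := by
      ext X
      simp [feasible]
    rw [this]
    refine (isClosed_iInter fun k => isClosed_iInter fun b =>
        isClosed_posSemidef.preimage (by fun_prop)).inter
      ((isClosed_iInter fun k => isClosed_iInter fun b => isClosed_iInter fun i =>
        isClosed_le (by fun_prop) continuous_const).inter
      ((isClosed_iInter fun k => isClosed_le ?_ continuous_const).inter
        (isClosed_closure.preimage continuous_entryMap)))
    unfold Matrix.trace
    simp only [Matrix.diag]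
    fun_prop
  refine IsCompact.of_isClosed_subset
    (isCompact_univ_pi fun k : Fin d => isCompact_univ_pi fun _ : Bool =>
      isCompact_univ_pi fun _ : Fin m ⊕ Fin n => isCompact_univ_pi fun _ : Fin m ⊕ Fin n =>
        isCompact_closedBall (0 : ℂ) (β k)) hc ?_
  rintro X ⟨h1, h2, -, -⟩ k - b - i - j -
  rw [mem_closedBall_zero_iff]
  have hi := (Complex.le_def.1 ((h1 k b).diag_nonneg (i := i))).1
  have hj := (Complex.le_def.1 ((h1 k b).diag_nonneg (i := j))).1
  have h3 := normSq_apply_le (h1 k b) i j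
  rw [Complex.normSq_eq_norm_sq] at h3
  have h4 := mul_le_mul (h2 k b i) (h2 k b j) hj (hi.trans (h2 k b i))
  exact abs_le_of_sq_le_sq' (by nlinarith) (hi.trans (h2 k b i)) |>.2

/-- The regularizer: the sum of the relative entropies to multiples of the identity, up to a
constant. -/
noncomputable def regularizer (τ : Fin d → ℝ) (X : Blocks m n d) : ℝ :=
  ∑ k, ∑ b, (negEntropy (X k b) -
    -- Reference point: each of the two blocks is a multiple of the identity with trace τ(k)/2.
    (Real.log (τ k / (2 * ((m : ℝ) + n))) + 1) * (X k b).trace.re)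

lemma continuousOn_regularizer : ContinuousOn (regularizer τ) (feasible β τ S) := by
  refine continuousOn_finsetSum _ fun k _ => continuousOn_finsetSum _ fun b _ => ?_
  refine ContinuousOn.sub ?_ ?_
  · refine (continuousOn_negEntropy (τ k)).comp (f := fun X : Blocks m n d => X k b)
      (by fun_prop) fun X hX => ?_
    exact ⟨hX.1 k b, trace_le_of_feasible hX k b⟩
  · unfold Matrix.trace
    simp only [Matrix.diag]
    fun_prop

lemma sq_entryMap_sub_le {X Z : Blocks m n d} (hX : X ∈ feasible β τ S)
    (hZ : Z ∈ feasible β τ S) (i : Fin m) (j : Fin n) (l : Fin d) :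
    (entryMap X i j l - entryMap Z i j l) ^ 2 ≤
      4 * (∑ k, β k) * ∑ k, ∑ b, frobSq (msqrt (X k b) - msqrt (Z k b)) := by
  have h := sq_entryMap_le (X - Z) i j l
  rw [map_sub] at h
  refine h.trans ?_
  have h0 : ∀ k (b : Bool), 0 ≤ frobSq (msqrt (X k b) - msqrt (Z k b)) := fun k b =>
    Finset.sum_nonneg fun _ _ => Finset.sum_nonneg fun _ _ => Complex.normSq_nonneg _
  have hβ : ∀ k, 0 ≤ β k := fun k =>
    (Complex.le_def.1 ((hX.1 k true).diag_nonneg (i := Sum.inl i))).1.trans (hX.2.1 k true _)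
  have h1 := Finset.sum_sq_le_sum_mul_sum_of_sq_le_mul Finset.univ
    (r := fun p : Fin d × Bool => ‖(X - Z) p.1 p.2 (Sum.inl i) (Sum.inr j)‖)
    (f := fun p => 2 * β p.1) (g := fun p => frobSq (msqrt (X p.1 p.2) - msqrt (Z p.1 p.2)))
    (fun p _ => by have := hβ p.1; positivity) (fun p _ => h0 _ _)
    (fun p _ => by
      rw [← Complex.normSq_eq_norm_sq]
      exact normSq_sub_apply_le (hX.1 _ _) (hZ.1 _ _) (hX.2.1 _ _) (hZ.2.1 _ _) (by simp))
  refine h1.trans_eq ?_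
  rw [Fintype.sum_prod_type, Fintype.sum_prod_type]
  congr 1
  simp only [Fintype.sum_bool, Finset.mul_sum]
  exact Finset.sum_congr rfl fun k _ => by ring

/-- Strong convexity of the regularizer with respect to the entries of the tensor. -/
lemma regularizer_strongly_convex {X Y : Blocks m n d} (hX : X ∈ feasible β τ S)
    (hY : Y ∈ feasible β τ S) (hB : 0 < ∑ k, β k) {s : ℝ} (hs : 0 < s) (hs1 : s < 1)
    (i : Fin m) (j : Fin n) (l : Fin d) :
    regularizer τ ((1 - s) • X + s • Y) +
        s * (1 - s) * ((entryMap X i j l - entryMap Y i j l) ^ 2 / (4 * ∑ k, β k)) ≤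
      (1 - s) * regularizer τ X + s * regularizer τ Y := by
  have hs' : 0 < 1 - s := by linarith
  have hZ : (1 - s) • X + s • Y ∈ feasible β τ S :=
    convex_feasible hX hY hs'.le hs.le (by ring)
  have hZe : entryMap ((1 - s) • X + s • Y) i j l =
      (1 - s) * entryMap X i j l + s * entryMap Y i j l := by
    rw [map_add, map_smul, map_smul]; rfl
  have h1 := sq_entryMap_sub_le hX hZ i j l
  have h2 := sq_entryMap_sub_le hY hZ i j l
  rw [hZe] at h1 h2
  have h3 : ∀ k b, negEntropy (((1 - s) • X + s • Y) k b) -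
        (Real.log (τ k / (2 * ((m : ℝ) + n))) + 1) * ((((1 - s) • X + s • Y) k b).trace.re) +
        ((1 - s) * frobSq (msqrt (X k b) - msqrt (((1 - s) • X + s • Y) k b)) +
        s * frobSq (msqrt (Y k b) - msqrt (((1 - s) • X + s • Y) k b))) ≤
      (1 - s) * (negEntropy (X k b) -
        (Real.log (τ k / (2 * ((m : ℝ) + n))) + 1) * (X k b).trace.re) +
      s * (negEntropy (Y k b) -
        (Real.log (τ k / (2 * ((m : ℝ) + n))) + 1) * (Y k b).trace.re) := by
    intro k b
    have := negEntropy_convex_gain (hX.1 k b) (hY.1 k b) hs hs1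
    have e : (((1 - s) • X + s • Y) k b).trace.re =
        (1 - s) * (X k b).trace.re + s * (Y k b).trace.re := by
      simp [trace_add, trace_smul]
    rw [e]
    simp only [Pi.add_apply, Pi.smul_apply]
    linarith
  have h4 := Finset.sum_le_sum fun k (_ : k ∈ Finset.univ) =>
    Finset.sum_le_sum fun b (_ : b ∈ Finset.univ) => h3 k b
  simp only [Finset.sum_add_distrib, ← Finset.mul_sum] at h4
  refine le_trans ?_ h4
  refine add_le_add le_rfl ?_
  rw [← mul_div_assoc, div_le_iff₀ (by positivity)]
  have g1 := mul_le_mul_of_nonneg_left h1 hs'.le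
  have g2 := mul_le_mul_of_nonneg_left h2 hs.le
  -- Variance identity for the two-point distribution with weights 1 - s and s.
  calc _ = (1 - s) * (entryMap X i j l -
          ((1 - s) * entryMap X i j l + s * entryMap Y i j l)) ^ 2 +
        s * (entryMap Y i j l - ((1 - s) * entryMap X i j l + s * entryMap Y i j l)) ^ 2 := by
        ring
    _ ≤ _ := add_le_add g1 g2
    _ = _ := by ring

lemma regularizer_sub_le {X Y : Blocks m n d} (hX : X ∈ feasible β τ S)
    (hY : Y ∈ feasible β τ S) (hp : 0 < (m : ℝ) + n)
    (hlog : 1 ≤ Real.log (2 * ((m : ℝ) + n))) :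
    regularizer τ X - regularizer τ Y ≤ Real.log (2 * ((m : ℝ) + n)) * ∑ k, τ k := by
  rw [regularizer, regularizer, ← Finset.sum_sub_distrib, Finset.mul_sum]
  refine Finset.sum_le_sum fun k _ => ?_
  set q := 2 * ((m : ℝ) + n) with hq
  have hq0 : 0 < q := by positivity
  have hl : ∀ b, _ := fun b => le_negEntropy (hY.1 k b) (trace_le_of_feasible hY k b) hq0
  have hu : ∀ b, _ := fun b => negEntropy_le (hX.1 k b) (trace_le_of_feasible hX k b)
  have hl1 := hl true
  have hl2 := hl false
  have hu1 := hu true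
  have hu2 := hu false
  have hx1 := trace_re_nonneg (hX.1 k true)
  have hx2 := trace_re_nonneg (hX.1 k false)
  have hx := hX.2.2.1 k
  simp only [Fintype.card_sum, Fintype.card_fin, Nat.cast_add] at hl1 hl2
  simp only [Fintype.sum_bool]
  have hc : ((m : ℝ) + n) * (τ k / q) = τ k / 2 := by rw [hq]; field_simp
  rw [hc] at hl1 hl2
  -- If τ(k) = 0 the traces vanish; the logarithm of the quotient cannot be split then.
  rcases (show 0 ≤ τ k by linarith).eq_or_lt with h | h
  · have e1 : (X k true).trace.re = 0 := by linarith
    have e2 : (X k false).trace.re = 0 := by linarith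
    rw [e1] at hu1 ⊢
    rw [e2] at hu2 ⊢
    rw [← h] at hl1 hl2 ⊢
    simp only [mul_zero, zero_mul] at *
    linarith
  · rw [Real.log_div h.ne' hq0.ne'] at *
    -- Per slice, the value at `X` is at most (log q - 1) τ(k), where log q ≥ 1 is needed, and the
    -- value at `Y` is at least -τ(k).
    have := mul_le_mul_of_nonneg_left hx (sub_nonneg.2 hlog)
    linarith

end Blocks

/-! ### Bounded subgradients. -/

section Subgradient

/-- A convex Lipschitz function on an interval has a subgradient at every point, the end points
included, that is bounded by the Lipschitz constant. -/
lemma exists_subgradient {f : ℝ → ℝ} {a b : ℝ} {G : ℝ≥0} (hf : ConvexOn ℝ (Set.Icc a b) f)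
    (hG : LipschitzOnWith G f (Set.Icc a b)) {p : ℝ} (hp : p ∈ Set.Icc a b) :
    ∃ g : ℝ, |g| ≤ G ∧ ∀ u ∈ Set.Icc a b, f p + g * (u - p) ≤ f u := by
  have hlip : ∀ u ∈ Set.Icc a b, |f u - f p| ≤ G * |u - p| := fun u hu => by
    simpa [Real.dist_eq] using hG.dist_le_mul u hu p hp
  -- Left slopes at `p`, whose supremum is the subgradient. Inserting -G covers the left end point,
  -- where there are none.
  set L : Set ℝ :=
    insert (-(G : ℝ)) ((fun u => (f p - f u) / (p - u)) '' {u | u ∈ Set.Icc a b ∧ u < p}) with hL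
  have hne : L.Nonempty := Set.insert_nonempty _ _
  have hupper : ∀ v ∈ Set.Icc a b, p < v → ∀ x ∈ L, x ≤ (f v - f p) / (v - p) := by
    rintro v hv hpv x (rfl | ⟨u, ⟨hu, hup⟩, rfl⟩)
    · rw [le_div_iff₀ (sub_pos.2 hpv)]
      have := abs_le.1 (hlip v hv)
      rw [abs_of_pos (sub_pos.2 hpv)] at this
      linarith [this.1]
    · exact hf.slope_mono_adjacent hu hv hup hpv
  have hG' : ∀ x ∈ L, x ≤ G := by
    rintro x (rfl | ⟨u, ⟨hu, hup⟩, rfl⟩)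
    · linarith [G.coe_nonneg]
    · dsimp only
      rw [div_le_iff₀ (sub_pos.2 hup)]
      have := abs_le.1 (hlip u hu)
      rw [abs_of_neg (sub_neg.2 hup)] at this
      linarith [this.1]
  have hbdd : BddAbove L := ⟨G, hG'⟩
  refine ⟨sSup L, abs_le.2 ⟨le_csSup hbdd (Set.mem_insert _ _), csSup_le hne hG'⟩,
    fun u hu => ?_⟩
  rcases lt_trichotomy u p with h | rfl | h
  · have := le_csSup hbdd (Set.mem_insert_of_mem (-(G : ℝ))
      (Set.mem_image_of_mem (fun u => (f p - f u) / (p - u)) (show u ∈ {u | _} from ⟨hu, h⟩)))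
    rw [div_le_iff₀ (sub_pos.2 h)] at this
    linarith
  · simp
  · have := csSup_le hne (hupper u hu h)
    rw [le_div_iff₀ (sub_pos.2 h)] at this
    linarith

end Subgradient

/-! ### Regularized leaders. -/

section FollowTheLeader

variable {E : Type*} [AddCommGroup E] [Module ℝ E]

/-- A minimizer of a strongly convex function is separated from all other points. -/
lemma add_le_of_isMinOn_of_strongly_convex {K : Set E} (hK : Convex ℝ K) {F : E → ℝ} {x y : E}
    (hx : x ∈ K) (hy : y ∈ K) (hmin : IsMinOn F K x) {q : ℝ}
    (hsc : ∀ s : ℝ, 0 < s → s < 1 →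
      F ((1 - s) • x + s • y) + s * (1 - s) * q ≤ (1 - s) * F x + s * F y) :
    F x + q ≤ F y := by
  -- Minimality is tested on the segment towards `y`; after division by s, let s → 0.
  have h : ∀ s : ℝ, 0 < s → s < 1 → (1 - s) * q ≤ F y - F x := by
    intro s h0 h1
    have hz := isMinOn_iff.1 hmin _
      (hK hx hy (sub_nonneg.2 h1.le) h0.le (sub_add_cancel 1 s))
    have := hsc s h0 h1
    refine le_of_mul_le_mul_left ?_ h0
    linarith
  have ht : Filter.Tendsto (fun s : ℝ => (1 - s) * q) (nhdsWithin 0 (Set.Ioi 0)) (nhds q) := by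
    have : Continuous fun s : ℝ => (1 - s) * q := by fun_prop
    simpa using (this.tendsto 0).mono_left nhdsWithin_le_nhds
  have := le_of_tendsto ht (by
    filter_upwards [Ioo_mem_nhdsGT (zero_lt_one' ℝ)] with s hs using h s hs.1 hs.2)
  linarith

/-- The regularized leaders for all linear losses. -/
lemma exists_leader {V : Type*} [AddCommGroup V] [Module ℝ V] [TopologicalSpace V]
    [IsTopologicalAddGroup V] [ContinuousSMul ℝ V] [T2Space V] [FiniteDimensional ℝ V]
    [TopologicalSpace E] {I : Type*} {K : Set E} (hK : Convex ℝ K) (hKc : IsCompact K)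
    (hne : K.Nonempty) {R : E → ℝ} (hR : ContinuousOn R K) {a : E →ₗ[ℝ] V} (ha : Continuous a)
    (e : I → V →ₗ[ℝ] ℝ) {B : ℝ}
    (hsc : ∀ x ∈ K, ∀ y ∈ K, ∀ i, ∀ s : ℝ, 0 < s → s < 1 →
      R ((1 - s) • x + s • y) + s * (1 - s) * ((e i (a x) - e i (a y)) ^ 2 / (4 * B)) ≤
        (1 - s) * R x + s * R y)
    {η : ℝ} (hη : 0 < η) (θ : V →ₗ[ℝ] ℝ) :
    ∃ x ∈ K, (∀ y ∈ K, R x / η + θ (a x) ≤ R y / η + θ (a y)) ∧ ∀ y ∈ K, ∀ i,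
      R x / η + θ (a x) + (e i (a x) - e i (a y)) ^ 2 / (4 * B) / η ≤ R y / η + θ (a y) := by
  have hcont : ContinuousOn (fun x => R x / η + θ (a x)) K :=
    (hR.div_const η).add ((θ.continuous_of_finiteDimensional.comp ha).continuousOn)
  obtain ⟨x, hx, hmin⟩ := hKc.exists_isMinOn hne hcont
  refine ⟨x, hx, fun y hy => hmin hy, fun y hy i => ?_⟩
  refine add_le_of_isMinOn_of_strongly_convex hK hx hy hmin fun s h0 h1 => ?_
  have := div_le_div_of_nonneg_right (hsc x hx y hy i s h0 h1) hη.le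
  simp only [map_add, map_smul, smul_eq_mul]
  rw [add_div, add_div] at this
  linear_combination this

end FollowTheLeader

/-! ### The algorithm and its regret. -/

section Algorithm

variable {m n d : ℕ}

/-- The entry of a tensor at the index triple of a round, as a linear functional. -/
def Round.entryFunctional (r : Round m n d) : Tensor m n d →ₗ[ℝ] ℝ where
  toFun := r.entry
  map_add' _ _ := rfl
  map_smul' _ _ := rfl

open Classical in
/-- A subgradient of the loss function of the round `r` at `p`, if there is one that is bounded
by `G`. -/
noncomputable def Round.subgradient (G : ℝ≥0) (r : Round m n d) (p : ℝ) : ℝ :=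
  if h : ∃ g : ℝ, |g| ≤ G ∧ ∀ u ∈ Set.Icc (-1 : ℝ) 1, r.loss p + g * (u - p) ≤ r.loss u then
    h.choose
  else 0

lemma Round.subgradient_spec {G : ℝ≥0} {r : Round m n d} (hr : r.Admissible G) {p : ℝ}
    (hp : p ∈ Set.Icc (-1 : ℝ) 1) :
    |r.subgradient G p| ≤ G ∧
      ∀ u ∈ Set.Icc (-1 : ℝ) 1, r.loss p + r.subgradient G p * (u - p) ≤ r.loss u := by
  have h := exists_subgradient hr.1 hr.2 hp
  rw [Round.subgradient, dif_pos h]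
  exact h.choose_spec

/-- The sum of the linearized losses of the completed rounds, if the tensor maintained is the
function `A` of this sum. -/
noncomputable def linearizedLoss (G : ℝ≥0) (A : (Tensor m n d →ₗ[ℝ] ℝ) → Tensor m n d)
    (history : List (Round m n d)) : Tensor m n d →ₗ[ℝ] ℝ :=
  history.foldl (fun θ r => θ + r.subgradient G (r.entry (A θ)) • r.entryFunctional) 0

/-- Follow the leader with respect to the linearized losses. -/
noncomputable def followLeader (G : ℝ≥0) (A : (Tensor m n d →ₗ[ℝ] ℝ) → Tensor m n d) :
    Algorithm m n d :=
  fun history => A (linearizedLoss G A history)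

lemma Algorithm.tensorAt_castSucc {T : ℕ} (alg : Algorithm m n d) (r : Fin (T + 1) → Round m n d)
    (t : Fin T) : alg.tensorAt r t.castSucc = alg.tensorAt (fun t => r t.castSucc) t := by
  unfold Algorithm.tensorAt
  rw [List.ofFn_succ', List.concat_eq_append, List.take_append_of_le_length]
  · rfl
  · simp [t.isLt.le]

lemma Algorithm.tensorAt_last {T : ℕ} (alg : Algorithm m n d) (r : Fin (T + 1) → Round m n d) :
    alg.tensorAt r (Fin.last T) = alg (List.ofFn fun t : Fin T => r t.castSucc) := by
  unfold Algorithm.tensorAt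
  rw [List.ofFn_succ', List.concat_eq_append, List.take_append_of_le_length]
  · rw [List.take_of_length_le (by simp)]
  · simp

/-- Potential argument: Φ will be the optimal regularized value. By the subgradient inequality, the
true regret against `U` plus the accumulated linear loss of `U` is at most ∑ g_t p_t, which Φ
controls round by round. -/
lemma followLeader_regret_le_aux {G : ℝ≥0} {A : (Tensor m n d →ₗ[ℝ] ℝ) → Tensor m n d}
    (hA : ∀ θ i j k, A θ i j k ∈ Set.Icc (-1 : ℝ) 1)
    {Φ : (Tensor m n d →ₗ[ℝ] ℝ) → ℝ} {c : ℝ} (hc : 0 ≤ c)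
    (hΦ : ∀ θ (r : Round m n d) (g : ℝ),
      Φ θ + g * r.entry (A θ) - c * g ^ 2 ≤ Φ (θ + g • r.entryFunctional))
    {U : Tensor m n d} (hU : ∀ i j k, U i j k ∈ Set.Icc (-1 : ℝ) 1) {T : ℕ}
    (r : Fin T → Round m n d) (hr : ∀ t, (r t).Admissible G) :
    Φ 0 + (∑ t, (r t).loss ((r t).entry ((followLeader G A).tensorAt r t)) -
        ∑ t, (r t).loss ((r t).entry U)) - T * (c * (G : ℝ) ^ 2) +
      linearizedLoss G A (List.ofFn r) U ≤ Φ (linearizedLoss G A (List.ofFn r)) := by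
  induction T with
  | zero => simp [linearizedLoss]
  | succ T ih =>
    have h := ih (fun t => r t.castSucc) fun t => hr _
    rw [Fin.sum_univ_castSucc, Fin.sum_univ_castSucc]
    simp only [Algorithm.tensorAt_castSucc, Algorithm.tensorAt_last]
    set θ := linearizedLoss G A (List.ofFn fun t : Fin T => r t.castSucc) with hθ
    have hstep : linearizedLoss G A (List.ofFn r) = θ +
        (r (Fin.last T)).subgradient G ((r (Fin.last T)).entry (A θ)) •
          (r (Fin.last T)).entryFunctional := by
      rw [List.ofFn_succ', List.concat_eq_append, hθ]
      simp [linearizedLoss, List.foldl_append]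
    have hp : followLeader G A (List.ofFn fun t : Fin T => r t.castSucc) = A θ := rfl
    rw [hstep, hp]
    set ρ := r (Fin.last T)
    obtain ⟨hg, hsub⟩ := Round.subgradient_spec (hr (Fin.last T))
      (p := ρ.entry (A θ)) (hA θ _ _ _)
    change |ρ.subgradient G _| ≤ _ at hg
    have hsubU := hsub (ρ.entry U) (hU _ _ _)
    change ρ.loss _ + ρ.subgradient G _ * _ ≤ ρ.loss _ at hsubU
    set g := ρ.subgradient G (ρ.entry (A θ))
    have h2 := hΦ θ ρ g
    have h3 : g ^ 2 ≤ (G : ℝ) ^ 2 := sq_le_sq' (abs_le.1 hg).1 (abs_le.1 hg).2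
    have h4 := mul_le_mul_of_nonneg_left h3 hc
    have h5 : (θ + g • ρ.entryFunctional) U = θ U + g * ρ.entry U := rfl
    rw [h5]
    push_cast
    linarith

lemma Algorithm.regret_le {T : ℕ} {alg : Algorithm m n d} {S : Set (Tensor m n d)}
    (hne : S.Nonempty) {r : Fin T → Round m n d} {b : ℝ}
    (h : ∀ U ∈ S, ∑ t, (r t).loss ((r t).entry (alg.tensorAt r t)) -
      ∑ t, (r t).loss ((r t).entry U) ≤ b) : alg.regret S r ≤ b := by
  have : Nonempty S := hne.to_subtype
  rw [Algorithm.regret, sub_le_comm]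
  exact le_ciInf fun U => sub_le_comm.1 (h U U.2)

lemma mem_Icc_of_mem_closure_convexHull {S : Set (Tensor m n d)}
    (hbox : ∀ A ∈ S, ∀ i j k, A i j k ∈ Set.Icc (-1 : ℝ) 1) {A : Tensor m n d}
    (hA : A ∈ closure (convexHull ℝ S)) (i : Fin m) (j : Fin n) (k : Fin d) :
    A i j k ∈ Set.Icc (-1 : ℝ) 1 := by
  have hconv : Convex ℝ {A : Tensor m n d | A i j k ∈ Set.Icc (-1 : ℝ) 1} := by
    rintro x hx y hy a b ha hb hab
    exact convex_Icc (-1 : ℝ) 1 hx hy ha hb hab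
  have hclosed : IsClosed {A : Tensor m n d | A i j k ∈ Set.Icc (-1 : ℝ) 1} :=
    isClosed_Icc.preimage (f := fun A : Tensor m n d => A i j k) (by fun_prop)
  exact closure_minimal (convexHull_min (fun A hA => hbox A hA i j k) hconv) hclosed hA

variable {β τ : Fin d → ℝ} {S : Set (Tensor m n d)}

/-- The regret of the regularized leader for a given learning rate. -/
lemma exists_algorithm_regret_le (hne : S.Nonempty)
    (hbox : ∀ A ∈ S, ∀ i j k, A i j k ∈ Set.Icc (-1 : ℝ) 1) (hdec : SetDecomposable β τ S)
    (hB : 0 < ∑ k, β k) (hp : 0 < (m : ℝ) + n) (hlog : 1 ≤ Real.log (2 * ((m : ℝ) + n)))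
    (G : ℝ≥0) {η : ℝ} (hη : 0 < η) :
    ∃ alg : Algorithm m n d, (∀ history, alg history ∈ closure (convexHull ℝ S)) ∧
      ∀ (T : ℕ) (r : Fin T → Round m n d), (∀ t, (r t).Admissible G) →
        alg.regret S r ≤ Real.log (2 * ((m : ℝ) + n)) * (∑ k, τ k) / η +
          η * ((∑ k, β k) * (G : ℝ) ^ 2 * T) := by
  obtain ⟨U₀, hU₀⟩ := hne
  obtain ⟨X₀, hX₀, -⟩ := exists_feasible_entryMap_eq hdec hU₀
  choose x hx hleast hmin using exists_leader (convex_feasible (β := β) (τ := τ) (S := S))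
    isCompact_feasible ⟨X₀, hX₀⟩ continuousOn_regularizer continuous_entryMap
    (fun r : Round m n d => r.entryFunctional)
    (fun X hX Y hY r s h0 h1 => regularizer_strongly_convex hX hY hB h0 h1 _ _ _) hη
  set A : (Tensor m n d →ₗ[ℝ] ℝ) → Tensor m n d := fun θ => entryMap (x θ)
  have hAmem : ∀ θ, A θ ∈ closure (convexHull ℝ S) := fun θ => (hx θ).2.2.2
  refine ⟨followLeader G A, fun h => hAmem _, fun T r hr => Algorithm.regret_le ⟨U₀, hU₀⟩ ?_⟩
  intro U hU
  obtain ⟨Y, hY, rfl⟩ := exists_feasible_entryMap_eq hdec hU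
  set B := ∑ k, β k
  have h := followLeader_regret_le_aux (G := G) (A := A)
    (fun θ => mem_Icc_of_mem_closure_convexHull hbox (hAmem θ))
    (Φ := fun θ => regularizer τ (x θ) / η + θ (A θ)) (c := η * B) (by positivity)
    (fun θ ρ g => by
      have h1 := hmin θ (x (θ + g • ρ.entryFunctional)) (hx _) ρ
      have h2 : (θ + g • ρ.entryFunctional) (A (θ + g • ρ.entryFunctional)) =
        θ (A (θ + g • ρ.entryFunctional)) + g * ρ.entry (A (θ + g • ρ.entryFunctional)) := rfl
      rw [h2]
      change regularizer τ (x θ) / η + θ (A θ) +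
        (ρ.entry (A θ) - ρ.entry (A (θ + g • ρ.entryFunctional))) ^ 2 / (4 * B) / η ≤
        _ + θ (A (θ + g • ρ.entryFunctional)) at h1
      set p := ρ.entry (A θ)
      set u := ρ.entry (A (θ + g • ρ.entryFunctional))
      -- Completing the square: the separation of the old leader from the new one pays for the
      -- change of prediction.
      have h3 : g * (p - u) - η * B * g ^ 2 ≤ (p - u) ^ 2 / (4 * B) / η := by
        rw [div_div, le_div_iff₀ (by positivity)]
        nlinarith [sq_nonneg ((p - u) - 2 * (B * η) * g)]
      linarith)
    (hbox _ hU) r hr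
  set θ := linearizedLoss G A (List.ofFn r)
  -- The final leader is no worse than the lift `Y` of the competitor, which cancels the linear loss
  -- of the competitor.
  have hfin := hleast θ Y hY
  have hD := div_le_div_of_nonneg_right (regularizer_sub_le hY (hx 0) hp hlog) hη.le
  rw [sub_div] at hD
  simp only [LinearMap.zero_apply, add_zero] at h
  change _ ≤ regularizer τ (x θ) / η + θ (entryMap (x θ)) at h
  linarith

end Algorithm

end OnlineTensor

/-! ### Degenerate cases and the choice of the learning rate. -/

theorem mainTheorem1 (m n d : ℕ) (β τ : Fin d → ℝ) (hβ : ∀ k, 0 ≤ β k) (hβ₁ : 1 ≤ ∑ k, β k)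
    (hτ : ∀ k, 0 ≤ τ k) (G : ℝ≥0) (S : Set (OnlineTensor.Tensor m n d)) (hne : S.Nonempty)
    (hbox : ∀ A ∈ S, ∀ i j k, A i j k ∈ Set.Icc (-1 : ℝ) 1)
    (hdec : OnlineTensor.SetDecomposable β τ S) (T : ℕ) :
    ∃ alg : OnlineTensor.Algorithm m n d,
      (∀ history, alg history ∈ closure (convexHull ℝ S)) ∧
      ∀ r : Fin T → OnlineTensor.Round m n d, (∀ t, (r t).Admissible G) →
        alg.regret S r ≤
          2 * (G : ℝ) * Real.sqrt
            (Real.log (2 * ((m : ℝ) + (n : ℝ))) * (T : ℝ) * (∑ k, τ k) * (∑ k, β k)) := by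
  have hB : 0 < ∑ k, β k := by linarith
  obtain ⟨U₀, hU₀⟩ := hne
  have hU₀' : U₀ ∈ closure (convexHull ℝ S) := subset_closure (subset_convexHull ℝ S hU₀)
  -- A constant algorithm is enough if it never does worse than a competitor.
  have hconst : (∀ r : Fin T → OnlineTensor.Round m n d, (∀ t, (r t).Admissible G) →
      ∀ U ∈ S, ∀ t, (r t).loss ((r t).entry U₀) ≤ (r t).loss ((r t).entry U)) →
      ∃ alg : OnlineTensor.Algorithm m n d,
      (∀ history, alg history ∈ closure (convexHull ℝ S)) ∧
      ∀ r : Fin T → OnlineTensor.Round m n d, (∀ t, (r t).Admissible G) →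
        alg.regret S r ≤
          2 * (G : ℝ) * Real.sqrt
            (Real.log (2 * ((m : ℝ) + (n : ℝ))) * (T : ℝ) * (∑ k, τ k) * (∑ k, β k)) := by
    intro h
    refine ⟨fun _ => U₀, fun _ => hU₀', fun r hr => ?_⟩
    refine (OnlineTensor.Algorithm.regret_le ⟨U₀, hU₀⟩ fun U hU => sub_nonpos.2
      (Finset.sum_le_sum fun t _ => h r hr U hU t)).trans (by positivity)
  rcases T.eq_zero_or_pos with rfl | hT
  · exact hconst fun _ _ _ _ t => t.elim0
  rcases m.eq_zero_or_pos with rfl | hm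
  · exact hconst fun r _ _ _ t => (r t).index.1.elim0
  rcases n.eq_zero_or_pos with rfl | hn
  · exact hconst fun r _ _ _ t => (r t).index.2.1.elim0
  rcases G.2.eq_or_lt with hG | hG
  · refine hconst fun r hr U hU t => ?_
    have := (hr t).2.dist_le_mul _ (hbox _ hU₀ (r t).index.1 (r t).index.2.1 (r t).index.2.2)
      _ (hbox _ hU (r t).index.1 (r t).index.2.1 (r t).index.2.2)
    rw [show (G : ℝ) = 0 from hG.symm, zero_mul, Real.dist_eq] at this
    exact sub_nonpos.1 ((le_abs_self _).trans this)
  have hmn : (2 : ℝ) ≤ (m : ℝ) + n := by exact_mod_cast (by omega : 2 ≤ m + n)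
  have hlog : 1 ≤ Real.log (2 * ((m : ℝ) + n)) := by
    rw [Real.le_log_iff_exp_le (by linarith)]
    linarith [Real.exp_one_lt_d9]
  set D := Real.log (2 * ((m : ℝ) + n)) * ∑ k, τ k with hD
  have hD0 : 0 ≤ D := mul_nonneg (by linarith) (Finset.sum_nonneg fun k _ => hτ k)
  -- If D = 0, the regularizer is constant on the feasible set, so strong convexity at a midpoint
  -- forces all tensors in `S` to agree.
  rcases hD0.eq_or_lt with hD0 | hD0
  · obtain ⟨X, hX, hXU⟩ := OnlineTensor.exists_feasible_entryMap_eq hdec hU₀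
    refine hconst fun r hr U hU t => ?_
    obtain ⟨Y, hY, hYU⟩ := OnlineTensor.exists_feasible_entryMap_eq hdec hU
    have hZ := OnlineTensor.convex_feasible hX hY (a := 1 - 1 / 2) (b := 1 / 2)
      (by norm_num) (by norm_num) (by norm_num)
    have h1 := OnlineTensor.regularizer_strongly_convex hX hY hB (s := 1 / 2) (by norm_num)
      (by norm_num) (r t).index.1 (r t).index.2.1 (r t).index.2.2
    have h2 := OnlineTensor.regularizer_sub_le hX hZ (by linarith) hlog
    have h3 := OnlineTensor.regularizer_sub_le hY hZ (by linarith) hlog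
    rw [← hD, ← hD0] at h2 h3
    have h4 : (OnlineTensor.entryMap X (r t).index.1 (r t).index.2.1 (r t).index.2.2 -
        OnlineTensor.entryMap Y (r t).index.1 (r t).index.2.1 (r t).index.2.2) ^ 2 /
          (4 * ∑ k, β k) ≤ 0 := by linarith
    rw [div_le_iff₀ (by positivity), zero_mul] at h4
    have h5 := sub_eq_zero.1 (pow_eq_zero_iff two_ne_zero |>.1 (le_antisymm h4 (sq_nonneg _)))
    rw [hXU, hYU] at h5
    exact (congrArg (r t).loss h5).le
  set C := (∑ k, β k) * (G : ℝ) ^ 2 * T with hC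
  have hG' : (0 : ℝ) < G := hG
  have hT' : (0 : ℝ) < T := by exact_mod_cast hT
  have hC0 : 0 < C := by positivity
  -- This rate makes D/η and ηC both equal to √D √C.
  obtain ⟨alg, halg, hreg⟩ := OnlineTensor.exists_algorithm_regret_le ⟨U₀, hU₀⟩ hbox hdec hB
    (by linarith) hlog G (η := √D / √C) (by positivity)
  refine ⟨alg, halg, fun r hr => (hreg T r hr).trans_eq ?_⟩
  rw [← hD, ← hC]
  have e1 : Real.log (2 * ((m : ℝ) + n)) * (T : ℝ) * (∑ k, τ k) * (∑ k, β k) =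
      D * ((∑ k, β k) * T) := by rw [hD]; ring
  have e2 : √C = G * √((∑ k, β k) * T) := by
    rw [hC, show (∑ k, β k) * (G : ℝ) ^ 2 * T = (G : ℝ) ^ 2 * ((∑ k, β k) * T) by ring,
      Real.sqrt_mul (by positivity), Real.sqrt_sq hG'.le]
  have e3 : D / (√D / √C) + √D / √C * C = 2 * (√D * √C) := by
    have hd := Real.sqrt_pos.2 hD0
    have hc := Real.sqrt_pos.2 hC0
    have hd2 := Real.mul_self_sqrt hD0.le
    have hc2 := Real.mul_self_sqrt hC0.le
    conv_lhs => rw [← hd2, ← hc2]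
    rw [Real.sqrt_mul_self hd.le, Real.sqrt_mul_self hc.le]
    field_simp
    ring
  rw [e3, e1, Real.sqrt_mul hD0.le, e2]
  ring
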